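/- Let $n$ be a positive integer and let $I=\sqrt{-1}$. For $1\le i,j\le n$ and $q\in\mathbb{C}\setminus\{0,1,-1\}$ put $$L_{i,j}(q)=\sum_{k=-n+1}^{n}(-1)^{k+1}\,\frac{q^{k}-q^{-k}}{q-q^{-1}}\binom{2j+k-3}{i-1}\binom{n}{j+k-1},$$ where, for integers $a,b$, $\binom{a}{b}=\frac{a(a-1)\cdots(a-b+1)}{b!}$ if $b\ge 0$ and $\binom{a}{b}=0$ if $b<0$. Then, for all $1\le i,j\le n$, $$L_{i,j}(I)=\sum_{k=\lceil -n/2\rceil}^{\lfloor (n-1)/2\rfloor}(-1)^{k}\binom{2j+2k-2}{i-1}\binom{n}{j+2k},$$ and $$\det\bigl(L_{i,j}(I)\bigr)_{1\le i,j\le n}=2^{n(n-1)}.$$ -/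

import Mathlib

/-- The binomial coefficient with integer arguments: the generalized binomial coefficient
`a (a - 1) ⋯ (a - b + 1) / b!` if `0 ≤ b`, and `0` if `b < 0`. -/
def intBinom (a b : ℤ) : ℤ :=
  if 0 ≤ b then Ring.choose a b.toNat else 0

/-- The entry `L_{i,j}(q)` of the `n × n` matrix, with `1`-based indices `i`, `j`. -/
noncomputable def entryL (n : ℕ) (i j : ℤ) (q : ℂ) : ℂ :=
  ∑ k ∈ Finset.Icc (-(n : ℤ) + 1) (n : ℤ),
    (-1 : ℂ) ^ (k + 1) * ((q ^ k - q ^ (-k)) / (q - q⁻¹)) *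
      (intBinom (2 * j + k - 3) (i - 1) : ℂ) * (intBinom (n : ℤ) (j + k - 1) : ℂ)

/-- The `n × n` matrix `(L_{i,j}(q))`; the index `i : Fin n` stands for the row `i + 1`. -/
noncomputable def matrixL (n : ℕ) (q : ℂ) : Matrix (Fin n) (Fin n) ℂ :=
  Matrix.of fun i j => entryL n ((i : ℤ) + 1) ((j : ℤ) + 1) q

open Polynomial

/-! At `q = I` the matrix factors as `E * (S * H * S)` (`matrixL_I`), with `E` even binomials, `H`
the Hurwitz matrix of `(1 + x) ^ n` and `S` diagonal signs, so its determinant is `det E * det H`.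
Multiplying `H` by the unipotent `subOnePowMatrix` replaces `x ^ k` by `(x - 1) ^ k`. Column `k` of
the new product then lists the coefficients in `X = x - 1` of `(F(x) - F(-x)) / (2x)`, where `F = (1
+ x) ^ n (x - 1) ^ k`. By `exists_oddPart_eq` this is `2 ^ (n - 1) X ^ k` plus higher terms, so the
product is triangular with constant diagonal. -/

/-- The alternating sum of a polynomial at `u` and `-u` only sees the odd coefficients. -/
theorem aeval_sub_aeval_neg {R S : Type*} [CommRing R] [CommRing S] [Algebra R S]
    (F : R[X]) (n : ℕ) (hF : F.natDegree < 2 * n) (u : S) :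
    aeval u F - aeval (-u) F =
      2 * u * ∑ b ∈ Finset.range n, F.coeff (2 * b + 1) • u ^ (2 * b) := by
  rw [aeval_eq_sum_range' hF, aeval_eq_sum_range' hF, ← Finset.sum_sub_distrib]
  clear hF
  induction n with
  | zero => simp
  | succ n ih =>
    rw [show 2 * (n + 1) = 2 * n + 1 + 1 by ring, Finset.sum_range_succ, Finset.sum_range_succ, ih,
      Finset.sum_range_succ (n := n)]
    have h1 : (-u) ^ (2 * n) = u ^ (2 * n) := Even.neg_pow (even_two_mul n) u
    have h2 : (-u) ^ (2 * n + 1) = -u ^ (2 * n + 1) := Odd.neg_pow (odd_two_mul_add_one n) u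
    rw [h1, h2]
    simp only [Algebra.smul_def]
    ring

/-- The matrix of even binomial coefficients `C(2b, i)`. -/
def evenBinomMatrix (n : ℕ) : Matrix (Fin n) (Fin n) ℂ :=
  Matrix.of fun i b => ((2 * (b : ℕ)).choose i : ℂ)

/-- The Hurwitz matrix of `(1 + X) ^ n`. -/
noncomputable def binomHurwitz (n : ℕ) : Matrix (Fin n) (Fin n) ℂ :=
  Matrix.of fun b j => ((1 + X) ^ n * X ^ (j : ℕ) : ℂ[X]).coeff (2 * b + 1)

/-- The matrix whose columns are the coefficients of the powers of `X - 1`. -/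
noncomputable def subOnePowMatrix (n : ℕ) : Matrix (Fin n) (Fin n) ℂ :=
  Matrix.of fun j k => ((X - 1) ^ (k : ℕ) : ℂ[X]).coeff j

/-- The diagonal matrix of alternating signs. -/
def signMatrix (n : ℕ) : Matrix (Fin n) (Fin n) ℂ :=
  Matrix.diagonal fun b => (-1) ^ (b : ℕ)

theorem natDegree_X_sub_one_pow (k : ℕ) : ((X - 1) ^ k : ℂ[X]).natDegree = k := by
  rw [← C_1, natDegree_pow, natDegree_X_sub_C, mul_one]

theorem det_subOnePowMatrix (n : ℕ) : (subOnePowMatrix n).det = 1 := by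
  rw [Matrix.det_of_isUpperTriangular]
  · refine Finset.prod_eq_one fun k _ => ?_
    have h : ((X - 1) ^ (k : ℕ) : ℂ[X]).Monic := by
      rw [← C_1]; exact (monic_X_sub_C 1).pow _
    have h' := h.coeff_natDegree
    rwa [natDegree_X_sub_one_pow] at h'
  · intro j k hjk
    exact coeff_eq_zero_of_natDegree_lt ((natDegree_X_sub_one_pow k).trans_lt hjk)

theorem signMatrix_mul_self (n : ℕ) : signMatrix n * signMatrix n = 1 := by
  rw [signMatrix, Matrix.diagonal_mul_diagonal, ← Matrix.diagonal_one]
  congr 1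
  ext b
  rw [← mul_pow]
  simp

theorem binomHurwitz_mul_subOnePowMatrix (n : ℕ) (b k : Fin n) :
    (binomHurwitz n * subOnePowMatrix n) b k =
      ((1 + X) ^ n * (X - 1) ^ (k : ℕ) : ℂ[X]).coeff (2 * b + 1) := by
  have h : ((X - 1) ^ (k : ℕ) : ℂ[X]) =
      ∑ j : Fin n, C (((X - 1) ^ (k : ℕ) : ℂ[X]).coeff j) * X ^ (j : ℕ) := by
    conv_lhs => rw [as_sum_range_C_mul_X_pow' (p := ((X - 1) ^ (k : ℕ) : ℂ[X])) (n := n)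
      (by rw [natDegree_X_sub_one_pow]; exact k.2)]
    rw [Finset.sum_range]
  conv_rhs => rw [h, Finset.mul_sum, finsetSum_coeff]
  rw [Matrix.mul_apply]
  refine Finset.sum_congr rfl fun j _ => ?_
  rw [mul_left_comm, coeff_C_mul, mul_comm]
  rfl

/-- The odd part of `(1 + x) ^ n (x - 1) ^ k`, divided by `x`, as a polynomial in `X = x - 1`. -/
noncomputable def oddPart (n k : ℕ) : ℂ[X] :=
  ∑ b ∈ Finset.range n, ((1 + X) ^ n * (X - 1) ^ k : ℂ[X]).coeff (2 * b + 1) •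
    (1 + X) ^ (2 * b)

/-- With `x = 1 + X`, `F(x) = X ^ k (2 + X) ^ n`, while `F(-x)` is divisible by `X ^ n`, hence by `X
^ (k + 1)`. Only `F(x)` contributes to the lowest term: `2 ^ n / 2`. -/
theorem exists_oddPart_eq {n k : ℕ} (hk : k < n) :
    ∃ H : ℂ[X], oddPart n k = X ^ k * H ∧ H.coeff 0 = 2 ^ (n - 1) := by
  have hdeg : ((1 + X) ^ n * (X - 1) ^ k : ℂ[X]).natDegree < 2 * n := by
    refine natDegree_mul_le.trans_lt ?_
    rw [natDegree_X_sub_one_pow, add_comm 1, ← C_1, natDegree_pow, natDegree_X_add_C]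
    omega
  have key := aeval_sub_aeval_neg _ n hdeg (1 + X : ℂ[X])
  change _ = 2 * (1 + X) * oddPart n k at key
  simp only [map_mul, map_pow, map_add, map_sub, map_one, aeval_X] at key
  obtain ⟨m, rfl⟩ := Nat.exists_eq_add_of_lt hk
  have key' : 2 * (1 + X) * oddPart (k + m + 1) k =
      X ^ k * ((2 + X) ^ (k + m + 1) - (-1) ^ (m + 1) * X ^ (m + 1) * (2 + X) ^ k) := by
    rw [← key, show (1 + -(1 + X) : ℂ[X]) = -1 * X by ring,
      show (-(1 + X) - 1 : ℂ[X]) = -1 * (2 + X) by ring, mul_pow, mul_pow,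
      show (1 + (1 + X) : ℂ[X]) = 2 + X by ring, show (1 + X - 1 : ℂ[X]) = X by ring]
    have : ((-1) ^ k * (-1) ^ k : ℂ[X]) = 1 := by rw [← mul_pow]; simp
    linear_combination (-(-1) ^ (m + 1) * X ^ (k + m + 1) * (2 + X) ^ k) * this
  -- Bézout: `-X + (1/2) * 2(1 + X) = 1`.
  have hcop : IsCoprime (X ^ k : ℂ[X]) (2 * (1 + X)) := by
    refine IsCoprime.pow_left ⟨-1, C (1 / 2), ?_⟩
    have h2 : (C (1 / 2) * 2 : ℂ[X]) = 1 := by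
      rw [show (2 : ℂ[X]) = C 2 from rfl, ← C_mul]; norm_num
    linear_combination (1 + X) * h2
  obtain ⟨H, hH⟩ := hcop.dvd_of_dvd_mul_left ⟨_, key'⟩
  refine ⟨H, hH, ?_⟩
  have hR : 2 * (1 + X) * H =
      (2 + X) ^ (k + m + 1) - (-1) ^ (m + 1) * X ^ (m + 1) * (2 + X) ^ k := by
    refine mul_left_cancel₀ (pow_ne_zero k (X_ne_zero (R := ℂ))) ?_
    rw [← key', hH]
    ring
  have h0 := congrArg (eval 0) hR
  simp only [eval_mul, eval_add, eval_sub, eval_pow, eval_X, eval_one, eval_ofNat,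
    ← coeff_zero_eq_eval_zero, add_zero, mul_one, zero_pow (Nat.succ_ne_zero m), mul_zero,
    zero_mul, sub_zero] at h0
  rw [pow_succ'] at h0
  exact mul_left_cancel₀ two_ne_zero h0

theorem evenBinomMatrix_mul_apply (n : ℕ) (i k : Fin n) :
    (evenBinomMatrix n * (binomHurwitz n * subOnePowMatrix n)) i k =
      (oddPart n k).coeff i := by
  rw [Matrix.mul_apply, oddPart, finsetSum_coeff, Finset.sum_range]
  refine Finset.sum_congr rfl fun b _ => ?_
  rw [binomHurwitz_mul_subOnePowMatrix, coeff_smul, coeff_one_add_X_pow, smul_eq_mul, mul_comm]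
  rfl

theorem det_evenBinomMatrix_mul_binomHurwitz (n : ℕ) :
    (evenBinomMatrix n).det * (binomHurwitz n).det = 2 ^ (n * (n - 1)) := by
  have h : (evenBinomMatrix n * (binomHurwitz n * subOnePowMatrix n)).det =
      2 ^ (n * (n - 1)) := by
    rw [Matrix.det_of_isLowerTriangular]
    · rw [Finset.prod_congr rfl (g := fun _ => (2 : ℂ) ^ (n - 1)), Finset.prod_const,
        Finset.card_univ, Fintype.card_fin, ← pow_mul, mul_comm]
      intro k _
      obtain ⟨H, hH, h0⟩ := exists_oddPart_eq k.2
      rw [evenBinomMatrix_mul_apply, hH, coeff_X_pow_mul', if_pos le_rfl, Nat.sub_self, h0]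
    · intro i k hik
      have hik' : (i : ℕ) < k := hik
      obtain ⟨H, hH, -⟩ := exists_oddPart_eq k.2
      rw [evenBinomMatrix_mul_apply, hH, coeff_X_pow_mul', if_neg (by omega)]
  rwa [Matrix.det_mul, Matrix.det_mul, det_subOnePowMatrix, mul_one] at h

theorem intBinom_natCast (a b : ℕ) : intBinom a b = (a.choose b : ℤ) := by
  simp [intBinom, Ring.choose_natCast]

theorem intBinom_of_neg {a b : ℤ} (h : b < 0) : intBinom a b = 0 := by
  simp [intBinom, h]

theorem intBinom_natCast_of_lt {a : ℕ} {b : ℤ} (h : (a : ℤ) < b) : intBinom a b = 0 := by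
  lift b to ℕ using by omega
  rw [intBinom_natCast, Nat.choose_eq_zero_of_lt (by omega), Nat.cast_zero]

theorem I_zpow_sub_even (m : ℤ) : Complex.I ^ (2 * m) - Complex.I ^ (-(2 * m)) = 0 := by
  rw [zpow_neg, zpow_mul, ← inv_zpow]
  norm_num [← inv_zpow]

theorem I_zpow_sub_odd (m : ℤ) :
    (Complex.I ^ (2 * m + 1) - Complex.I ^ (-(2 * m + 1))) / (Complex.I - Complex.I⁻¹) =
      (-1) ^ m := by
  have h2 : (Complex.I - Complex.I⁻¹) ≠ 0 := by
    rw [Complex.inv_I, sub_neg_eq_add, ← two_mul]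
    exact mul_ne_zero two_ne_zero Complex.I_ne_zero
  rw [div_eq_iff h2, zpow_neg, zpow_add₀ Complex.I_ne_zero, zpow_mul, zpow_one, mul_inv,
    ← inv_zpow]
  norm_num
  ring

theorem entryL_I (n : ℕ) (i j : ℤ) :
    entryL n i j Complex.I =
      ∑ k ∈ Finset.Icc ⌈-(n : ℚ) / 2⌉ ⌊((n : ℚ) - 1) / 2⌋,
        (-1 : ℂ) ^ k * (intBinom (2 * j + 2 * k - 2) (i - 1) : ℂ) *
          (intBinom (n : ℤ) (j + 2 * k) : ℂ) := by
  symm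
  -- Terms with even `k` vanish because `I ^ k = I ^ (-k)`.
  refine Finset.sum_of_injOn (fun m => 2 * m + 1) (fun a _ b _ h => by simpa using h) ?_ ?_ ?_
  · intro m hm
    simp only [Finset.coe_Icc, Set.mem_Icc, Int.ceil_le, Int.le_floor] at hm ⊢
    have h1 : -(n : ℚ) ≤ 2 * m := by linarith [hm.1]
    have h2 : (2 : ℚ) * m ≤ n - 1 := by linarith [hm.2]
    have h1' : -(n : ℤ) ≤ 2 * m := by exact_mod_cast h1
    have h2' : 2 * m ≤ (n : ℤ) - 1 := by exact_mod_cast h2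
    omega
  · intro k hk hk'
    rcases Int.even_or_odd' k with ⟨m, rfl | rfl⟩
    · rw [I_zpow_sub_even]; simp
    · refine absurd ⟨m, ?_, rfl⟩ hk'
      simp only [Finset.mem_Icc, Finset.coe_Icc, Set.mem_Icc, Int.ceil_le, Int.le_floor] at hk ⊢
      have h1' : -(n : ℤ) ≤ 2 * m := by omega
      have h2' : 2 * m ≤ (n : ℤ) - 1 := by omega
      have h1 : -(n : ℚ) ≤ 2 * m := by exact_mod_cast h1'
      have h2 : (2 : ℚ) * m ≤ n - 1 := by exact_mod_cast h2'
      constructor <;> linarith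
  · intro m _
    have hsign : (-1 : ℂ) ^ (2 * m + 1 + 1) = 1 := Even.neg_one_zpow ⟨m + 1, by ring⟩
    rw [I_zpow_sub_odd, hsign, one_mul,
      show 2 * j + (2 * m + 1) - 3 = 2 * j + 2 * m - 2 by ring,
      show j + (2 * m + 1) - 1 = j + 2 * m by ring]

theorem coeff_one_add_X_pow_mul_X_pow (n b j : ℕ) :
    ((1 + X) ^ n * X ^ j : ℂ[X]).coeff (2 * b + 1) =
      (intBinom (n : ℤ) (2 * b + 1 - j) : ℂ) := by
  rw [coeff_mul_X_pow']
  split_ifs with h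
  · rw [coeff_one_add_X_pow, show (2 * b + 1 - j : ℤ) = ((2 * b + 1 - j : ℕ) : ℤ) by omega,
      intBinom_natCast, Int.cast_natCast]
  · rw [intBinom_of_neg (by omega), Int.cast_zero]

/-- Substituting `k = b - j` turns the sum into a matrix product, and `(-1) ^ (b - j)` splits into a
row sign and a column sign. -/
theorem matrixL_I (n : ℕ) :
    matrixL n Complex.I = evenBinomMatrix n * (signMatrix n * binomHurwitz n * signMatrix n) := by
  ext i j
  have hi := i.2
  have hj := j.2
  rw [Matrix.mul_apply, matrixL, Matrix.of_apply, entryL_I]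
  simp only [signMatrix, Matrix.mul_diagonal, Matrix.diagonal_mul]
  have hterm : ∀ b : Fin n, evenBinomMatrix n i b *
      ((-1) ^ (b : ℕ) * binomHurwitz n b j * (-1) ^ (j : ℕ)) =
      (-1 : ℂ) ^ ((b : ℤ) - j) * (intBinom (2 * ((j : ℤ) + 1) + 2 * ((b : ℤ) - j) - 2)
        ((i : ℤ) + 1 - 1) : ℂ) * (intBinom (n : ℤ) ((j : ℤ) + 1 + 2 * ((b : ℤ) - j)) : ℂ) := by
    intro b
    have hs : (-1 : ℂ) ^ ((b : ℤ) - j) = (-1) ^ (b : ℕ) * (-1) ^ (j : ℕ) := by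
      rw [zpow_sub₀ (by norm_num), zpow_natCast, zpow_natCast, div_eq_mul_inv, ← inv_pow,
        inv_neg_one]
    rw [hs, show 2 * ((j : ℤ) + 1) + 2 * ((b : ℤ) - j) - 2 = ((2 * b : ℕ) : ℤ) by push_cast; ring,
      show (i : ℤ) + 1 - 1 = ((i : ℕ) : ℤ) by ring, intBinom_natCast,
      show (j : ℤ) + 1 + 2 * ((b : ℤ) - j) = 2 * (b : ℕ) + 1 - (j : ℕ) by ring,
      binomHurwitz, Matrix.of_apply, coeff_one_add_X_pow_mul_X_pow, evenBinomMatrix,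
      Matrix.of_apply, Int.cast_natCast]
    ring
  rw [Finset.sum_congr rfl fun b _ => hterm b]
  -- The two index ranges differ, but these bounds place every nonzero term in both.
  have hzero : ∀ m : ℤ, (intBinom (n : ℤ) ((j : ℤ) + 1 + 2 * m) : ℂ) ≠ 0 →
      0 ≤ (j : ℤ) + 1 + 2 * m ∧ (j : ℤ) + 1 + 2 * m ≤ n := by
    intro m hm
    by_contra hcon
    refine hm ?_
    rcases lt_or_ge ((j : ℤ) + 1 + 2 * m) 0 with h | h
    · rw [intBinom_of_neg h, Int.cast_zero]
    · rw [intBinom_natCast_of_lt (by omega), Int.cast_zero]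
  symm
  refine Finset.sum_bij_ne_zero (fun b _ _ => (b : ℤ) - j) ?_ ?_ ?_ ?_
  · intro b _ hb
    have h := hzero _ (right_ne_zero_of_mul hb)
    simp only [Finset.mem_Icc, Int.ceil_le, Int.le_floor]
    have h1' : -(n : ℤ) ≤ 2 * ((b : ℤ) - j) := by omega
    have h2' : 2 * ((b : ℤ) - j) ≤ (n : ℤ) - 1 := by omega
    have h1 : -(n : ℚ) ≤ 2 * (((b : ℤ) - j : ℤ) : ℚ) := by exact_mod_cast h1'
    have h2 : (2 : ℚ) * (((b : ℤ) - j : ℤ) : ℚ) ≤ n - 1 := by exact_mod_cast h2'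
    constructor <;> linarith
  · intro b _ _ c _ _ h
    exact Fin.ext (by omega)
  · intro m _ hm
    have h := hzero _ (right_ne_zero_of_mul hm)
    have hb : ((((j : ℤ) + m).toNat : ℕ) : ℤ) - j = m := by omega
    refine ⟨⟨((j : ℤ) + m).toNat, by omega⟩, Finset.mem_univ _, ?_, hb⟩
    dsimp only
    rwa [hb]
  · intros
    rfl

theorem corollary5p5 (n : ℕ) (hn : 1 ≤ n) :
    (∀ i ∈ Finset.Icc (1 : ℤ) (n : ℤ), ∀ j ∈ Finset.Icc (1 : ℤ) (n : ℤ),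
      entryL n i j Complex.I =
        ∑ k ∈ Finset.Icc ⌈-(n : ℚ) / 2⌉ ⌊((n : ℚ) - 1) / 2⌋,
          (-1 : ℂ) ^ k * (intBinom (2 * j + 2 * k - 2) (i - 1) : ℂ) *
            (intBinom (n : ℤ) (j + 2 * k) : ℂ)) ∧
    (matrixL n Complex.I).det = 2 ^ (n * (n - 1)) := by
  refine ⟨fun i _ j _ => entryL_I n i j, ?_⟩
  have hs : (signMatrix n).det * (signMatrix n).det = 1 := by
    rw [← Matrix.det_mul, signMatrix_mul_self, Matrix.det_one]
  rw [matrixL_I, Matrix.det_mul, Matrix.det_mul, Matrix.det_mul,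
    ← det_evenBinomMatrix_mul_binomHurwitz]
  linear_combination ((evenBinomMatrix n).det * (binomHurwitz n).det) * hs
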